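/- **Conventions.** Let $n\ge 1$. An *$n$-premaniplex* is a graph (semi-edges and parallel edges allowed) with edges properly coloured by $\{0,\dots,n-1\}$, in which every vertex (called a *flag*) $x$ has exactly one $i$-adjacent flag $r_i x$ for each colour $i$ (with $r_ix=x$ at a semi-edge), and in which every path with colour sequence $(i,j,i,j)$ is closed whenever $|i-j|>1$. It is an *$n$-maniplex* if it is moreover non-empty, connected, and without semi-edges and parallel edges. Its *facets* are the connected components left after removing the edges of colour $n-1$; $\Phi_{n-1}$ denotes the facet of the flag $\Phi$. An $n$-premaniplex *is a polytope* if it is isomorphic, as an edge-coloured graph, to the flag graph of an abstract polytope of rank $n$, in which two flags are joined by an edge of colour $i$ when they are distinct and have the same faces of every rank other than $i$. Let $G$ be a group. A *Cayley extender* $(\mathcal K,r_n,\xi)$ with voltage group $G$ consists of an $n$-maniplex $\mathcal K$, a permutation $r_n$ of its flags with $r_n^2=1$ that commutes with $r_0,\dots,r_{n-2}$ (so that it permutes the facets), and a function $\xi$ from the facets of $\mathcal K$ to $G$ with $\xi(r_n(F))=\xi(F)^{-1}$ for every facet $F$. It is always assumed that (a) the elements $\xi(F)$ generate $G$, and (b)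 $\xi(F)\ne 1$ for every facet $F$ such that $r_n$ is the identity on $F$, or $r_n\Phi$ is adjacent in $\mathcal K$ to $\Phi$ for some flag $\Phi$ of $F$. The extender is *canonical* if $r_n=\mathrm{Id}$. Let $\mathcal K_{r_n}$ be the $(n+1)$-premaniplex obtained from $\mathcal K$ by adding edges of colour $n$ joining each flag $\Phi$ to $r_n\Phi$. The voltage of a dart of $\mathcal K_{r_n}$ starting at $\Phi$ is $\xi(\Phi_{n-1})$ if its colour is $n$, and $1$ otherwise; the voltage of a path $d_1d_2\cdots d_\ell$ is $\xi(d_\ell)\cdots\xi(d_1)$ (and $1$ for a path of length $0$). The *Cayley extension* $\mathcal K_{r_n}^{\xi}$ is the derived graph: its flags are the pairs $(\Phi,g)$ with $\Phi$ a flag of $\mathcal K$ and $g\in G$, and the $i$-adjacent flag of $(\Phi,g)$ is $(r_i\Phi,\xi(d)g)$, where $d$ is the dart of colour $i$ starting at $\Phi$. If $r_n=\mathrm{Id}$ it is denoted by $\mathcal K^\xi$. **Proposition.** Let $(\mathcal K,r_n,\xi)$ be a Cayley extender. Then $\mathcal K_{r_n}^{\xi}$ is a polytope if and only if the following two conditions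 hold: 1. $\mathcal K$ is a polytope, and 2. for all flags $\Phi,\Psi$ of $\mathcal K$ and all $k\in\{0,\dots,n\}$: if there is a path from $\Phi$ to $\Psi$ in $\mathcal K_{r_n}$ that uses only colours in $[k,n]$ and has trivial voltage, then there is also a path from $\Phi$ to $\Psi$ in $\mathcal K_{r_n}$ that uses only colours in $[k,n-1]$ (for $k=n$ this set of colours is empty, and the condition says $\Phi=\Psi$). **Corollary.** Let $(\mathcal K,\xi)$ be a canonical Cayley extender. Then $\mathcal K^{\xi}$ is a polytope if and only if $\mathcal K$ is a polytope. -/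

import Mathlib

universe u v

/-- Two colours are non-consecutive when they differ by more than one. -/
def NonConsecutive {n : ℕ} (i j : Fin n) : Prop :=
  (i : ℕ) + 1 < j ∨ (j : ℕ) + 1 < i

/-- A premaniplex of rank `n` with flag set `V`: a properly `n`-edge-coloured graph, possibly with
semi-edges and parallel edges, given by the map `r i` that sends each flag to its `i`-adjacent flag
(equal to it at a semi-edge), such that every `(i, j, i, j)`-path with `i`, `j` non-consecutive is
closed. The darts are the pairs `(x, i)`; the dart `(x, i)` goes from `x` to `r i x`
and its inverse is `(r i x, i)`. -/
structure Premaniplex (n : ℕ) (V : Type u) where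
  r : Fin n → V → V
  r_r : ∀ i x, r i (r i x) = x
  closed : ∀ i j, NonConsecutive i j → ∀ x, r j (r i (r j (r i x))) = x

namespace Premaniplex

variable {n : ℕ} {V : Type u} (X : Premaniplex n V)

/-- The endpoint of the path with initial flag `x` and the given colour sequence. -/
def endpoint : V → List (Fin n) → V
  | x, [] => x
  | x, i :: w => endpoint (X.r i x) w

/-- The paths from `x` to `y` that use only colours in `I`. A path starting at `x` is determined by
its colour sequence, and is represented by it. -/
def paths (I : Set (Fin n)) (x y : V) : Set (List (Fin n)) :=
  {w | (∀ i ∈ w, i ∈ I) ∧ X.endpoint x w = y}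

/-- A maniplex is a non-empty connected premaniplex without semi-edges and parallel edges, that is,
every `r i` and every `r i ∘ r j`, `i ≠ j`, is fixed-point-free. In particular its `(i, j, i, j)`-paths
with `i`, `j` non-consecutive are alternating 4-cycles. -/
structure IsManiplex : Prop where
  nonempty : Nonempty V
  connected : ∀ x y, (X.paths Set.univ x y).Nonempty
  no_semiedge : ∀ i x, X.r i x ≠ x
  no_parallel : ∀ i j, i ≠ j → ∀ x, X.r i x ≠ X.r j x

theorem endpoint_append (x : V) (w w' : List (Fin n)) :
    X.endpoint x (w ++ w') = X.endpoint (X.endpoint x w) w' := by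
  induction w generalizing x with
  | nil => rfl
  | cons i w ih => exact ih _

theorem endpoint_reverse (x : V) (w : List (Fin n)) :
    X.endpoint (X.endpoint x w) w.reverse = x := by
  induction w generalizing x with
  | nil => rfl
  | cons i w ih =>
    rw [List.reverse_cons, endpoint_append]
    change X.endpoint (X.endpoint (X.endpoint (X.r i x) w) w.reverse) [i] = x
    rw [ih]
    exact X.r_r i x

/-- Being connected by a path with colours in `I`. -/
def componentSetoid (I : Set (Fin n)) : Setoid V where
  r x y := (X.paths I x y).Nonempty
  iseqv :=
    { refl := fun _ => ⟨[], by simp, rfl⟩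
      symm := by
        rintro x y ⟨w, hw, rfl⟩
        exact ⟨w.reverse, fun i hi => hw i (List.mem_reverse.1 hi), X.endpoint_reverse x w⟩
      trans := by
        rintro x y z ⟨w, hw, rfl⟩ ⟨w', hw', rfl⟩
        refine ⟨w ++ w', fun i hi => ?_, X.endpoint_append x w w'⟩
        rcases List.mem_append.1 hi with h | h
        · exact hw i h
        · exact hw' i h }

/-- The facets of a premaniplex of rank `n`: the connected components after removing the edges of
colour `n - 1`. -/
def Facet : Type u :=
  Quotient (X.componentSetoid {i | (i : ℕ) + 1 ≠ n})

/-- The facet of a flag. -/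
def facetOf (x : V) : X.Facet :=
  Quotient.mk _ x

end Premaniplex

/-- In a poset with a rank function, two distinct flags (maximal chains) are `i`-adjacent when they
have the same faces of every rank other than `i`. -/
def FlagAdj {P : Type u} [PartialOrder P] (rank : P → ℤ) (i : ℤ) (Φ Ψ : Flag P) : Prop :=
  Φ ≠ Ψ ∧ ∀ F, rank F ≠ i → (F ∈ Φ ↔ F ∈ Ψ)

/-- An abstract polytope of rank `n`: a poset with a least face, of rank `-1`, and a greatest face,
of rank `n`, ranked (so that each flag has exactly `n + 2` faces), satisfying the diamond condition
and strongly flag-connected. -/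
structure AbstractPolytope (n : ℕ) where
  Face : Type u
  [partialOrder : PartialOrder Face]
  [boundedOrder : BoundedOrder Face]
  rank : Face → ℤ
  rank_bot : rank ⊥ = -1
  rank_top : rank ⊤ = n
  rank_strictMono : StrictMono rank
  rank_covBy : ∀ F G : Face, F ⋖ G → rank G = rank F + 1
  /-- Between incident faces whose ranks differ by two there are exactly two faces. -/
  diamond : ∀ F G : Face, F < G → rank G = rank F + 2 → {H : Face | F < H ∧ H < G}.ncard = 2
  /-- Any two flags `Φ`, `Ψ` are joined by a sequence of successively adjacent flags, all of which
  contain `Φ ∩ Ψ`. -/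
  flagConnected : ∀ Φ Ψ : Flag Face,
    Relation.ReflTransGen
      (fun A B : Flag Face => (∃ i, FlagAdj rank i A B) ∧
        (Φ : Set Face) ∩ Ψ ⊆ A ∧ (Φ : Set Face) ∩ Ψ ⊆ B) Φ Ψ

attribute [instance] AbstractPolytope.partialOrder AbstractPolytope.boundedOrder

/-- A premaniplex of rank `n` is (the flag graph of) a polytope when it is isomorphic, as an
edge-coloured graph, to the graph whose vertices are the flags of some abstract polytope of rank `n`
and whose edges of colour `i` join `i`-adjacent flags. -/
def Premaniplex.IsPolytope {n : ℕ} {V : Type u} (X : Premaniplex n V) : Prop :=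
  ∃ (P : AbstractPolytope.{u} n) (e : V ≃ Flag P.Face),
    ∀ (i : Fin n) (x y : V), X.r i x = y ↔ FlagAdj P.rank (i : ℤ) (e x) (e y)

/-- The voltage of a path, for given voltages of the darts: the product of the voltages of its
darts, written from right to left. -/
def Premaniplex.pathVoltage {n : ℕ} {V : Type u} {G : Type v} [Group G] (X : Premaniplex n V)
    (dart : V → Fin n → G) : V → List (Fin n) → G
  | _, [] => 1
  | x, i :: w => X.pathVoltage dart (X.r i x) w * dart x i

/-- A voltage assignment making `X` a voltage premaniplex: inverse darts have inverse voltages and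
the `(i, j, i, j)`-paths with `i`, `j` non-consecutive have trivial voltage. -/
structure VoltageAssignment {n : ℕ} {V : Type u} (X : Premaniplex n V) (G : Type v) [Group G] where
  /-- The voltage of the dart of colour `i` that starts at `x`. -/
  dart : V → Fin n → G
  dart_inv : ∀ i x, dart (X.r i x) i = (dart x i)⁻¹
  closed : ∀ i j, NonConsecutive i j → ∀ x, X.pathVoltage dart x [i, j, i, j] = 1

namespace VoltageAssignment

variable {n : ℕ} {V : Type u} {X : Premaniplex n V} {G : Type v} [Group G]
  (ξ : VoltageAssignment X G)

/-- The voltage of the path with initial flag `x` and colour sequence `w`. -/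
def voltage (x : V) (w : List (Fin n)) : G :=
  X.pathVoltage ξ.dart x w

/-- The derived graph. -/
def derived : Premaniplex n (V × G) where
  r i p := (X.r i p.1, ξ.dart p.1 i * p.2)
  r_r i p := by simp [X.r_r, ξ.dart_inv]
  closed i j h p := by
    have h1 := X.closed i j h p.1
    have h2 := ξ.closed i j h p.1
    simp only [Premaniplex.pathVoltage, one_mul] at h2
    refine Prod.ext h1 ?_
    simp only [← mul_assoc]
    rw [h2, one_mul]

end VoltageAssignment

/-- A Cayley extender `(K, r_n, ξ)` on `K` with voltage group `G`. The permutation `r_n` restricts to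
isomorphisms between facets, that is, it commutes with `r_0, …, r_{n-2}`. As `r_n F` is the facet of
`r_n Φ` for any flag `Φ` of the facet `F`, the last field says `ξ (r_n F) = (ξ F)⁻¹`. -/
structure CayleyExtender {n : ℕ} {V : Type u} (K : Premaniplex n V) (G : Type v) [Group G] where
  isManiplex : K.IsManiplex
  rn : V → V
  rn_rn : ∀ Φ, rn (rn Φ) = Φ
  rn_comm : ∀ i : Fin n, (i : ℕ) + 1 < n → ∀ Φ, rn (K.r i Φ) = K.r i (rn Φ)
  ξ : K.Facet → G
  ξ_rn : ∀ Φ, ξ (K.facetOf (rn Φ)) = (ξ (K.facetOf Φ))⁻¹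

namespace CayleyExtender

variable {n : ℕ} {V : Type u} {K : Premaniplex n V} {G : Type v} [Group G]
  (E : CayleyExtender K G)

/-- The two conditions under which the derived graph of a Cayley extender is a maniplex: the voltages
of the facets generate the voltage group, and `ξ F ≠ 1` for every facet `F` such that `r_n` is the
identity on `F` or sends some flag of `F` to an adjacent flag. -/
structure Admissible : Prop where
  generates : Subgroup.closure (Set.range E.ξ) = ⊤
  ne_one : ∀ F : K.Facet,
    ((∀ Φ, K.facetOf Φ = F → E.rn Φ = Φ) ∨ (∃ Φ i, K.facetOf Φ = F ∧ E.rn Φ = K.r i Φ)) →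
      E.ξ F ≠ 1

/-- A canonical Cayley extender is one in which `r_n` is the identity. -/
def IsCanonical : Prop :=
  ∀ Φ, E.rn Φ = Φ

/-- The premaniplex `K_{r_n}`: `K` with the edges of colour `n` added according to `r_n`. -/
def preExtension : Premaniplex (n + 1) V where
  r := Fin.lastCases (motive := fun _ => V → V) E.rn K.r
  r_r i x := by
    induction i using Fin.lastCases with
    | last => simp [E.rn_rn]
    | cast i => simp [K.r_r]
  closed i j h x := by
    induction i using Fin.lastCases with
    | last =>
      induction j using Fin.lastCases with
      | last => simp [E.rn_rn]
      | cast j =>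
        have hj : (j : ℕ) + 1 < n := by
          have := j.2
          rcases h with h | h <;> simp at h <;> omega
        simp [E.rn_rn, K.r_r, E.rn_comm j hj]
    | cast i =>
      induction j using Fin.lastCases with
      | last =>
        have hi : (i : ℕ) + 1 < n := by
          have := i.2
          rcases h with h | h <;> simp at h <;> omega
        simp [E.rn_rn, K.r_r, E.rn_comm i hi]
      | cast j => simpa using K.closed i j h x

theorem facetOf_r (i : Fin n) (hi : (i : ℕ) + 1 < n) (x : V) :
    K.facetOf (K.r i x) = K.facetOf x :=
  Quotient.sound ⟨[i], by simpa using hi.ne, K.r_r i x⟩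

/-- The voltage assignment on `K_{r_n}`: a dart of colour `n` has the voltage of the facet at which it
starts, and the other darts have trivial voltage. -/
def voltageAssignment : VoltageAssignment E.preExtension G where
  dart Φ := Fin.lastCases (motive := fun _ => G) (E.ξ (K.facetOf Φ)) (fun _ => 1)
  dart_inv i x := by
    induction i using Fin.lastCases with
    | last => simp [preExtension, E.ξ_rn]
    | cast i => simp
  closed i j h x := by
    induction i using Fin.lastCases with
    | last =>
      induction j using Fin.lastCases with
      | last => simp [NonConsecutive] at h
      | cast j =>
        have hj : (j : ℕ) + 1 < n := by
          have := j.2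
          rcases h with h | h <;> simp at h <;> omega
        simp [Premaniplex.pathVoltage, preExtension, facetOf_r j hj, E.ξ_rn]
    | cast i =>
      induction j using Fin.lastCases with
      | last =>
        have hi : (i : ℕ) + 1 < n := by
          have := i.2
          rcases h with h | h <;> simp at h <;> omega
        simp [Premaniplex.pathVoltage, preExtension, facetOf_r i hi, E.ξ_rn]
      | cast j => simp [Premaniplex.pathVoltage]

/-- The Cayley extension `K_{r_n}^ξ`: the derived graph of `(K_{r_n}, ξ)`. -/
def extension : Premaniplex (n + 1) (V × G) :=
  E.voltageAssignment.derived

end CayleyExtender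

/-!
A premaniplex is the flag graph of a polytope if and only if it is a maniplex with the path
intersection property: flags joined by a path with colours `≥ k` and by a path with colours `< m` are
joined by a path with colours in `[k, m)` (`Premaniplex.isPolytope_iff`). In one direction the
property is strong flag-connectedness, since a path keeps the faces whose ranks are not among its
colours (`Premaniplex.joined_of_mem_iff`). In the other direction the faces of rank `i` are the
components without colour `i`, ordered by incidence. Distant colours commute, so a path without
colour `i` can be sorted into colours `> i` followed by colours `< i` (`Joined.exists_sorted`).
This makes incidence transitive and shows that every maximal chain of faces comes from a flag of the
premaniplex (`exists_flagOf_eq`). It also extends the path intersection property to arbitrary sets of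
colours (`PathIntersection.joined_diff`), from which injectivity of the correspondence between
flags, the adjacencies, the diamond condition and strong flag-connectedness follow.

For a Cayley extension, admissibility makes the derived graph a maniplex: the facet voltages
generate the group, which gives connectedness, and condition (b) excludes semi-edges and parallel
edges of colour `n`. Paths of the derived graph whose ends have the same group element are the lifts of paths of
trivial voltage, and a path without colour `n` never changes the group element. So the path
intersection property of the extension for `m ≤ n` is that of `K` once paths of trivial voltage with
colours in `[k, n]` can be replaced by paths with colours in `[k, n - 1]`; for `m = n + 1` it is trivial
(`CayleyExtender.pathIntersection_extension_iff`).
-/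

namespace Premaniplex

variable {n : ℕ} {V : Type u} (X : Premaniplex n V)

/-! ### Paths with restricted colours -/

/-- `X.Joined I x y` says that some path from `x` to `y` uses only colours in `I`. -/
def Joined (I : Set (Fin n)) (x y : V) : Prop :=
  (X.paths I x y).Nonempty

/-- The path intersection property: if `x` and `y` are joined by a path with colours `≥ k` and by a
path with colours `< m`, then they are joined by a path with colours in `[k, m)`. -/
def PathIntersection : Prop :=
  ∀ (x y : V) (k m : ℕ), X.Joined {c | k ≤ (c : ℕ)} x y → X.Joined {c | (c : ℕ) < m} x y →
    X.Joined {c | k ≤ (c : ℕ) ∧ (c : ℕ) < m} x y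

variable {X} {I J : Set (Fin n)} {x y z : V}

theorem Joined.refl (I : Set (Fin n)) (x : V) : X.Joined I x x :=
  (X.componentSetoid I).refl x

theorem Joined.symm (h : X.Joined I x y) : X.Joined I y x :=
  (X.componentSetoid I).symm h

theorem Joined.trans (h : X.Joined I x y) (h' : X.Joined I y z) : X.Joined I x z :=
  (X.componentSetoid I).trans h h'

theorem Joined.mono (h : X.Joined I x y) (hIJ : I ⊆ J) : X.Joined J x y := by
  obtain ⟨w, hw, hxy⟩ := h
  exact ⟨w, fun i hi => hIJ (hw i hi), hxy⟩

theorem IsManiplex.joined (h : X.IsManiplex) (hI : ∀ c, c ∈ I) (x y : V) : X.Joined I x y :=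
  Joined.mono (I := Set.univ) (h.connected x y) fun c _ => hI c

theorem joined_r {i : Fin n} (hi : i ∈ I) (x : V) : X.Joined I x (X.r i x) :=
  ⟨[i], by simpa using hi, rfl⟩

/-- Induction along a path, one dart being added at its beginning. -/
theorem Joined.induction {p : V → Prop} (h : X.Joined I x y) (hy : p y)
    (step : ∀ i ∈ I, ∀ z, X.Joined I (X.r i z) y → p (X.r i z) → p z) : p x := by
  obtain ⟨w, hw, rfl⟩ := h
  induction w generalizing x with
  | nil => exact hy
  | cons i w ih =>
    have hw' : ∀ j ∈ w, j ∈ I := fun j hj => hw j (List.mem_cons_of_mem _ hj)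
    exact step i (hw i List.mem_cons_self) x ⟨w, hw', rfl⟩ (ih hw' hy step)

theorem joined_empty_iff : X.Joined ∅ x y ↔ x = y := by
  refine ⟨fun h => h.induction (p := (· = y)) rfl fun i hi => hi.elim, ?_⟩
  rintro rfl
  exact .refl _ _

theorem Joined.eq_or_eq_r {i : Fin n} (h : X.Joined {i} x y) : y = x ∨ y = X.r i x := by
  refine h.induction (p := fun z => y = z ∨ y = X.r i z) (Or.inl rfl) fun j hj z _ ih => ?_
  obtain rfl : j = i := hj
  rw [X.r_r] at ih
  exact ih.symm

theorem r_comm {i j : Fin n} (h : NonConsecutive i j) (x : V) :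
    X.r j (X.r i x) = X.r i (X.r j x) := by
  have h' := congrArg (fun t => X.r i (X.r j t)) (X.closed i j h x)
  simpa only [X.r_r] using h'

/-- A dart whose colour commutes with all colours of a path can be moved past that path. -/
theorem Joined.map_r {i : Fin n} (hI : ∀ j ∈ I, NonConsecutive i j) (h : X.Joined I x y) :
    X.Joined I (X.r i x) (X.r i y) := by
  refine h.induction (p := fun z => X.Joined I (X.r i z) (X.r i y)) (.refl _ _)
    fun j hj z _ ih => ?_
  have := joined_r (X := X) hj (X.r i z)
  rw [r_comm (hI j hj)] at this
  exact this.trans ih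

/-- Colours on different sides of a missing colour commute, so a path without colour `a - 1` can be
sorted, the larger colours coming first. -/
theorem Joined.exists_sorted {a : ℕ} (h : X.Joined {c | (c : ℕ) + 1 ≠ a} x y) :
    ∃ z, X.Joined {c | a ≤ (c : ℕ)} x z ∧ X.Joined {c | (c : ℕ) + 1 < a} z y := by
  refine h.induction (p := fun x => ∃ z, X.Joined {c | a ≤ (c : ℕ)} x z ∧
    X.Joined {c | (c : ℕ) + 1 < a} z y) ⟨y, .refl _ _, .refl _ _⟩ ?_
  rintro i hi x - ⟨z, hxz, hzy⟩
  rcases lt_or_gt_of_ne (show (i : ℕ) + 1 ≠ a from hi) with hi | hi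
  · have h1 := hxz.map_r (i := i) fun j hj => Or.inl (hi.trans_le hj)
    rw [X.r_r] at h1
    refine ⟨X.r i z, h1, .trans ?_ hzy⟩
    have := joined_r (X := X) (I := {c | (c : ℕ) + 1 < a}) hi (X.r i z)
    rwa [X.r_r] at this
  · exact ⟨z, (joined_r (I := {c | a ≤ (c : ℕ)}) (Nat.lt_succ_iff.1 hi) x).trans hxz, hzy⟩

/-- The path intersection property for arbitrary sets of colours: flags that are joined without each
single colour of `S` (and with colours `< m` only) are joined without all colours of `S` at once.
With `j` the greatest colour of `S`, a path without `j` splits into a path with colours `> j`,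
which the path intersection property bounds by `m`, and a path with colours `< j`. -/
theorem PathIntersection.joined_diff (hX : X.PathIntersection) (S : Set ℕ) (m : ℕ) {x y : V}
    (hxy : X.Joined {c | (c : ℕ) < m} x y)
    (hS : ∀ j ∈ S, j < m → X.Joined {c | (c : ℕ) ≠ j} x y) :
    X.Joined {c | (c : ℕ) < m ∧ (c : ℕ) ∉ S} x y := by
  induction m using Nat.strong_induction_on generalizing x with
  | _ m ih =>
    by_cases hne : ∃ j, j ∈ S ∧ j < m
    swap
    · push Not at hne
      exact hxy.mono fun c hc => ⟨hc, fun h => (hne c h).not_gt hc⟩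
    obtain ⟨j, ⟨hjS, hjm⟩, hmax⟩ : ∃ j, (j ∈ S ∧ j < m) ∧ ∀ i, i ∈ S ∧ i < m → i ≤ j := by
      have hfin : {j | j ∈ S ∧ j < m}.Finite := (Set.finite_lt_nat m).subset fun j hj => hj.2
      exact hfin.exists_maximal hne |>.imp fun j hj => ⟨hj.1, fun i hi =>
        (le_total i j).elim id fun h => hj.2 hi h⟩
    have hxy' : X.Joined {c | (c : ℕ) + 1 ≠ j + 1} x y :=
      (hS j hjS hjm).mono fun c hc h => hc (Nat.succ_injective h)
    obtain ⟨z, hxz, hzy⟩ := hxy'.exists_sorted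
    replace hzy : X.Joined {c | (c : ℕ) < j} z y := hzy.mono fun c hc => Nat.succ_lt_succ_iff.1 hc
    have hxz' : X.Joined {c | (c : ℕ) < m} x z :=
      hxy.trans (hzy.symm.mono fun c hc => lt_trans hc hjm)
    have h1 := hX x z (j + 1) m hxz hxz'
    refine (h1.mono ?_).trans ((ih j hjm hzy fun i hi hij => ?_).mono ?_)
    · rintro c ⟨hc, hcm⟩
      exact ⟨hcm, fun h => (hmax c ⟨h, hcm⟩).not_gt hc⟩
    · refine (hxz.symm.mono fun c hc => ?_).trans (hS i hi (hij.trans hjm))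
      exact (hij.trans hc).ne'
    · rintro c ⟨hc, hcS⟩
      exact ⟨lt_trans hc hjm, hcS⟩

theorem PathIntersection.joined (hX : X.PathIntersection) (hxy : X.Joined Set.univ x y)
    (hI : ∀ c ∉ I, X.Joined {d | d ≠ c} x y) : X.Joined I x y := by
  refine (hX.joined_diff {j | ∃ c ∉ I, (c : ℕ) = j} n (hxy.mono fun c _ => c.2) ?_).mono ?_
  · rintro _ ⟨c, hc, rfl⟩ -
    exact (hI c hc).mono fun d hd h => hd (Fin.ext h)
  · rintro c ⟨-, hc⟩
    by_contra hcI
    exact hc ⟨c, hcI, rfl⟩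

end Premaniplex

/-! ### Flags of an abstract polytope -/

namespace AbstractPolytope

variable {n : ℕ} (P : AbstractPolytope.{u} n)

variable {P} in
theorem eq_of_mem_flag {Φ : Flag P.Face} {F G : P.Face} (hF : F ∈ Φ) (hG : G ∈ Φ)
    (h : P.rank F = P.rank G) : F = G := by
  rcases Φ.le_or_le hF hG with hle | hle
  · exact hle.eq_of_not_lt fun hlt => (P.rank_strictMono hlt).ne h
  · exact (hle.eq_of_not_lt fun hlt => (P.rank_strictMono hlt).ne' h).symm

theorem neg_one_le_rank (F : P.Face) : -1 ≤ P.rank F :=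
  P.rank_bot ▸ P.rank_strictMono.monotone bot_le

theorem rank_le (F : P.Face) : P.rank F ≤ n :=
  P.rank_top ▸ P.rank_strictMono.monotone le_top

/-- A flag has a face of every rank: the successor in the flag of a face covers it, by
maximality of the flag. -/
theorem exists_mem_flag_rank (Φ : Flag P.Face) (k : ℕ) (hk : k ≤ n + 1) :
    ∃ F ∈ Φ, P.rank F = k - 1 := by
  induction k with
  | zero => exact ⟨⊥, Φ.bot_mem, by simp [P.rank_bot]⟩
  | succ k ih =>
    obtain ⟨F, hF, hFk⟩ := ih (by omega)
    have hFtop : F < ⊤ := by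
      refine lt_top_iff_ne_top.2 fun h => ?_
      have := P.rank_top
      rw [h] at hFk
      omega
    obtain ⟨G, ⟨hG, hFG⟩, hmin⟩ :=
      (measure fun G : P.Face => (P.rank G + 1).toNat).wf.has_min
        {G | G ∈ Φ ∧ F < G} ⟨⊤, Φ.top_mem, hFtop⟩
    have hmin' : ∀ K ∈ Φ, F < K → P.rank G ≤ P.rank K := fun K hK hFK => by
      have h1 : ¬ (P.rank K + 1).toNat < (P.rank G + 1).toNat := hmin K ⟨hK, hFK⟩
      have := P.neg_one_le_rank K
      have := P.neg_one_le_rank G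
      omega
    have hcov : F ⋖ G := by
      refine ⟨hFG, fun H hFH hHG => ?_⟩
      have hH : H ∈ Φ := by
        refine Flag.mem_iff_forall_le_or_ge.2 fun K hK => ?_
        rcases Φ.le_or_le hK hF with hKF | hFK
        · exact Or.inr (hKF.trans hFH.le)
        rcases hFK.eq_or_lt with rfl | hFK
        · exact Or.inr hFH.le
        rcases Φ.le_or_le hK hG with hKG | hGK
        · rcases hKG.eq_or_lt with rfl | hKG
          · exact Or.inl hHG.le
          · exact absurd (P.rank_strictMono hKG) (hmin' K hK hFK).not_gt
        · exact Or.inl (hHG.le.trans hGK)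
      exact (hmin' H hH hFH).not_gt (P.rank_strictMono hHG)
    refine ⟨G, hG, ?_⟩
    rw [P.rank_covBy F G hcov, hFk]
    push_cast
    ring

/-- Adjacent flags have no common face of the rank in which they differ. -/
theorem not_mem_of_flagAdj {i : ℤ} {A B : Flag P.Face} (h : FlagAdj P.rank i A B) {F : P.Face}
    (hF : P.rank F = i) (hA : F ∈ A) : F ∉ B := by
  intro hB
  refine h.1 (SetLike.ext fun G => ?_)
  by_cases hG : P.rank G = i
  · constructor <;> intro hG'
    · rwa [eq_of_mem_flag hG' hA (hG.trans hF.symm)]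
    · rwa [eq_of_mem_flag hG' hB (hG.trans hF.symm)]
  · exact h.2 G hG

theorem flagAdj_rank_unique {i j : ℤ} {A B : Flag P.Face} (hi : FlagAdj P.rank i A B)
    (hj : FlagAdj P.rank j A B) : i = j := by
  by_contra hij
  refine hi.1 (SetLike.ext fun F => ?_)
  by_cases hF : P.rank F = i
  · exact hj.2 F (hF ▸ hij)
  · exact hi.2 F hF

theorem exists_colour_of_flagAdj {i : ℤ} {A B : Flag P.Face} (h : FlagAdj P.rank i A B) :
    ∃ c : Fin n, ((c : ℕ) : ℤ) = i := by
  obtain ⟨F, hF⟩ : ∃ F, P.rank F = i := by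
    by_contra! hne
    exact h.1 (SetLike.ext fun F => h.2 F (hne F))
  have h1 := P.neg_one_le_rank F
  have h2 := P.rank_le F
  have h3 : i ≠ -1 := fun hi =>
    P.not_mem_of_flagAdj h (P.rank_bot.trans hi.symm) A.bot_mem B.bot_mem
  have h4 : i ≠ n := fun hi =>
    P.not_mem_of_flagAdj h (P.rank_top.trans hi.symm) A.top_mem B.top_mem
  exact ⟨⟨i.toNat, by omega⟩, by simp; omega⟩

end AbstractPolytope

/-! ### The flag graph of a polytope -/

namespace Premaniplex

variable {n : ℕ} {V : Type u} {X : Premaniplex n V} {I : Set (Fin n)} {x y : V}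
  {P : AbstractPolytope.{u} n} {e : V ≃ Flag P.Face}

theorem Joined.mem_iff
    (he : ∀ (i : Fin n) (x y : V), X.r i x = y ↔ FlagAdj P.rank (i : ℤ) (e x) (e y))
    (h : X.Joined I x y) {F : P.Face} (hF : ∀ c ∈ I, P.rank F ≠ ((c : ℕ) : ℤ)) :
    F ∈ e x ↔ F ∈ e y :=
  h.induction (p := fun z => F ∈ e z ↔ F ∈ e y) Iff.rfl fun i hi z _ ih =>
    (((he i z _).1 rfl).2 F (hF i hi)).trans ih

/-- Strong flag-connectedness in terms of paths: two flags with the same faces of all ranks outside `I`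
are joined by a path with colours in `I`. -/
theorem joined_of_mem_iff
    (he : ∀ (i : Fin n) (x y : V), X.r i x = y ↔ FlagAdj P.rank (i : ℤ) (e x) (e y))
    (h : ∀ c : Fin n, c ∉ I → ∀ F, P.rank F = ((c : ℕ) : ℤ) → (F ∈ e x ↔ F ∈ e y)) :
    X.Joined I x y := by
  have key : ∀ B, Relation.ReflTransGen (fun A B : Flag P.Face => (∃ i, FlagAdj P.rank i A B) ∧
      (e x : Set P.Face) ∩ e y ⊆ A ∧ (e x : Set P.Face) ∩ e y ⊆ B) (e x) B →
      X.Joined I x (e.symm B) := by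
    intro B hB
    induction hB with
    | refl => simpa using Joined.refl I x
    | @tail A B _ hAB ih =>
      obtain ⟨⟨i, hi⟩, hA, hB⟩ := hAB
      obtain ⟨c, rfl⟩ := P.exists_colour_of_flagAdj hi
      have hr : X.r c (e.symm A) = e.symm B := (he _ _ _).2 (by simpa using hi)
      refine ih.trans (hr ▸ joined_r ?_ _)
      by_contra hc
      obtain ⟨F, hF, hFc⟩ := P.exists_mem_flag_rank (e x) (c + 1) (by omega)
      replace hFc : P.rank F = ((c : ℕ) : ℤ) := by rw [hFc]; push_cast; ring
      have hF' := (h c hc F hFc).1 hF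
      exact P.not_mem_of_flagAdj hi hFc (hA ⟨hF, hF'⟩) (hB ⟨hF, hF'⟩)
  simpa using key _ (P.flagConnected (e x) (e y))

theorem IsPolytope.isManiplex (h : X.IsPolytope) : X.IsManiplex := by
  obtain ⟨P, e, he⟩ := h
  exact
    { nonempty := e.nonempty
      connected := fun x y => joined_of_mem_iff he fun c hc => absurd (Set.mem_univ c) hc
      no_semiedge := fun i x hx => ((he i x x).1 hx).1 rfl
      no_parallel := fun i j hij x hx => hij <| Fin.ext <| Nat.cast_injective (R := ℤ) <|
        P.flagAdj_rank_unique ((he i x _).1 hx) ((he j x _).1 rfl) }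

theorem IsPolytope.pathIntersection (h : X.IsPolytope) : X.PathIntersection := by
  obtain ⟨P, e, he⟩ := h
  intro x y k m h1 h2
  refine joined_of_mem_iff he fun c hc F hF => ?_
  by_cases hk : k ≤ (c : ℕ)
  · refine h2.mem_iff he fun d hd hFd => hc ⟨hk, ?_⟩
    have : (c : ℕ) = d := by exact_mod_cast hF.symm.trans hFd
    exact this ▸ hd
  · refine h1.mem_iff he fun d hd hFd => hk ?_
    have : (c : ℕ) = d := by exact_mod_cast hF.symm.trans hFd
    exact this ▸ hd

end Premaniplex

/-! ### The polytope of a maniplex with the path intersection property -/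

namespace Premaniplex

variable {n : ℕ} {V : Type u} (X : Premaniplex n V)

/-- Pairs `(a, x)`, `(b, y)` define the same face when `a = b` and a path without colour `a - 1`
joins `x` to `y`. -/
def faceSetoid : Setoid (Fin (n + 2) × V) where
  r p q := p.1 = q.1 ∧ X.Joined {c | (c : ℕ) + 1 ≠ p.1} p.2 q.2
  iseqv :=
    { refl := fun _ => ⟨rfl, .refl _ _⟩
      symm := by
        rintro ⟨a, x⟩ ⟨b, y⟩ ⟨h, hxy⟩
        obtain rfl : a = b := h
        exact ⟨rfl, hxy.symm⟩
      trans := by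
        rintro ⟨a, x⟩ ⟨b, y⟩ ⟨c, z⟩ ⟨h, hxy⟩ ⟨h', hyz⟩
        obtain rfl : a = b := h
        exact ⟨h', hxy.trans hyz⟩ }

/-- The faces of a premaniplex: the faces of rank `i` are the connected components after removing the
edges of colour `i`. Faces are indexed by their level `a = i + 1`, so that the improper faces, of
ranks `-1` and `n`, are covered too: no edge has these colours, and in a connected
premaniplex there is one face of each of these ranks. -/
def Face : Type u :=
  Quotient X.faceSetoid

/-- The face of level `a` (and rank `a - 1`) of a flag. -/
def face (a : Fin (n + 2)) (x : V) : X.Face :=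
  Quotient.mk _ (a, x)

variable {X}

/-- The rank of a face, shifted by one. -/
def Face.level : X.Face → Fin (n + 2) :=
  Quotient.lift Prod.fst fun _ _ h => h.1

variable {I : Set (Fin n)} {x y z : V} {a b : Fin (n + 2)} {F G H : X.Face}

@[simp]
theorem level_face : (X.face a x).level = a :=
  rfl

theorem face_eq_face_iff : X.face a x = X.face a y ↔ X.Joined {c | (c : ℕ) + 1 ≠ a} x y :=
  Quotient.eq.trans (and_iff_right rfl)

theorem Face.exists_eq (F : X.Face) : ∃ x, X.face F.level x = F := by
  obtain ⟨⟨a, x⟩, rfl⟩ := Quotient.exists_rep F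
  exact ⟨x, rfl⟩

theorem Joined.face_eq (h : X.Joined I x y) (ha : ∀ c ∈ I, (c : ℕ) + 1 ≠ a) :
    X.face a x = X.face a y :=
  face_eq_face_iff.2 (h.mono ha)

theorem face_r {i : Fin n} (hi : (i : ℕ) + 1 ≠ a) (x : V) : X.face a (X.r i x) = X.face a x :=
  ((joined_r (Set.mem_singleton i) x).face_eq (by simpa using hi)).symm

/-- Two flags with a common face of level `a` have a mixture with the faces up to level `a` of the one
and the faces from level `a` on of the other. -/
theorem exists_mixture (h : X.face a x = X.face a y) :
    ∃ z, (∀ b ≤ a, X.face b z = X.face b x) ∧ ∀ b ≥ a, X.face b z = X.face b y := by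
  obtain ⟨z, hxz, hzy⟩ := (face_eq_face_iff.1 h).exists_sorted
  refine ⟨z, fun b hb => (hxz.face_eq fun c hc => ?_).symm, fun b hb => hzy.face_eq fun c hc => ?_⟩
  · exact (Nat.lt_succ_of_le (le_trans hb hc)).ne'
  · exact (Nat.lt_of_lt_of_le hc hb).ne

/-- Faces are ordered by incidence: having a common flag. -/
instance : PartialOrder X.Face where
  le F G := F.level ≤ G.level ∧ ∃ x, X.face F.level x = F ∧ X.face G.level x = G
  le_refl F := ⟨le_rfl, F.exists_eq.imp fun _ h => ⟨h, h⟩⟩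
  le_trans := by
    rintro F G H ⟨hFG, x, hxF, hxG⟩ ⟨hGH, y, hyG, hyH⟩
    obtain ⟨z, hz1, hz2⟩ := exists_mixture (hxG.trans hyG.symm)
    exact ⟨hFG.trans hGH, z, (hz1 _ hFG).trans hxF, (hz2 _ hGH).trans hyH⟩
  le_antisymm := by
    rintro F G ⟨hFG, x, hxF, hxG⟩ ⟨hGF, -⟩
    rw [← hxF, ← hxG, le_antisymm hFG hGF]

theorem Face.le_of_level_le (hF : X.face F.level x = F) (hG : X.face G.level x = G)
    (h : F.level ≤ G.level) : F ≤ G :=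
  ⟨h, x, hF, hG⟩

theorem Face.eq_of_le_of_level_eq (h : F ≤ G) (hl : F.level = G.level) : F = G := by
  obtain ⟨-, x, hF, hG⟩ := h
  rw [← hF, ← hG, hl]

theorem Face.level_strictMono : StrictMono (Face.level (X := X)) := fun _ _ h =>
  h.le.1.lt_of_ne fun hl => h.ne (Face.eq_of_le_of_level_eq h.le hl)

theorem face_lt_face (h : a < b) : X.face a x < X.face b x :=
  lt_of_le_of_ne (Face.le_of_level_le (x := x) rfl rfl h.le) fun heq => h.ne (congrArg Face.level heq)

/-- The faces of a flag of a premaniplex form a maximal chain. -/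
def flagOf (x : V) : Flag X.Face where
  carrier := {F | X.face F.level x = F}
  Chain' F hF G hG _ := (le_total F.level G.level).imp
    (Face.le_of_level_le hF hG) (Face.le_of_level_le hG hF)
  max_chain' s hs hsub := by
    refine hsub.antisymm fun F hF => ?_
    rcases hs.total hF (hsub (a := X.face F.level x) rfl) with h | h
    · exact (Face.eq_of_le_of_level_eq h rfl).symm
    · exact Face.eq_of_le_of_level_eq h rfl

theorem mem_flagOf : F ∈ flagOf (X := X) x ↔ X.face F.level x = F :=
  Iff.rfl

theorem exists_flagOf_eq [OrderTop X.Face] (Φ : Flag X.Face) : ∃ x, flagOf x = Φ := by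
  -- Climbing along the chain, each face is incident with some flag together with all smaller ones.
  have key : ∀ (m : ℕ) (F : X.Face), F ∈ Φ → (F.level : ℕ) = m →
      ∃ x, ∀ H ∈ Φ, H ≤ F → X.face H.level x = H := by
    intro m
    induction m using Nat.strong_induction_on with
    | _ m ih =>
      intro F hF hm
      by_cases hne : ∃ G, G ∈ Φ ∧ G < F
      · obtain ⟨G, ⟨hG, hGF⟩, hmax⟩ := (measure fun G : X.Face => n + 2 - (G.level : ℕ)).wf.has_min
          {G | G ∈ Φ ∧ G < F} hne
        obtain ⟨x, hx⟩ := ih G.level (hm ▸ Face.level_strictMono hGF) G hG rfl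
        obtain ⟨y, hyG, hyF⟩ := hGF.le.2
        obtain ⟨z, hz1, hz2⟩ := exists_mixture ((hx G hG le_rfl).trans hyG.symm)
        refine ⟨z, fun H hH hHF => ?_⟩
        rcases hHF.eq_or_lt with rfl | hHF
        · exact (hz2 _ hGF.le.1).trans hyF
        have hHG : H ≤ G := by
          refine Φ.chain_le.le_of_not_gt hG hH fun hGH => hmax H ⟨hH, hHF⟩ ?_
          have h1 : (G.level : ℕ) < H.level := Face.level_strictMono hGH
          have h2 := H.level.2
          change n + 2 - (H.level : ℕ) < n + 2 - (G.level : ℕ)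
          omega
        exact (hz1 _ hHG.1).trans (hx H hH hHG)
      · obtain ⟨x, hx⟩ := F.exists_eq
        refine ⟨x, fun H hH hHF => ?_⟩
        rcases hHF.eq_or_lt with rfl | hHF
        · exact hx
        · exact absurd ⟨H, hH, hHF⟩ hne
  obtain ⟨x, hx⟩ := key _ ⊤ Φ.top_mem rfl
  exact ⟨x, (SetLike.coe_injective (Φ.max_chain' (flagOf x).chain_le fun F hF =>
    hx F hF le_top)).symm⟩

/-- A connected premaniplex has exactly one face of rank `-1` and one of rank `n`. -/
@[reducible]
noncomputable def IsManiplex.boundedOrder (h : X.IsManiplex) : BoundedOrder X.Face where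
  bot := X.face 0 h.nonempty.some
  bot_le F := by
    obtain ⟨x, hx⟩ := F.exists_eq
    refine ⟨Fin.zero_le _, x, ?_, hx⟩
    exact face_eq_face_iff.2 (h.joined (fun c => c.1.succ_ne_zero) _ _)
  top := X.face (Fin.last _) h.nonempty.some
  le_top F := by
    obtain ⟨x, hx⟩ := F.exists_eq
    refine ⟨Fin.le_last _, x, hx, ?_⟩
    refine face_eq_face_iff.2 (h.joined (fun c => ?_) _ _)
    have := c.2
    simp
    omega

/-- Flags with the same faces of all ranks outside `I` are joined by a path with colours in `I`. -/
theorem PathIntersection.joined_of_face_eq (hX : X.PathIntersection) (h : X.IsManiplex)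
    (hI : ∀ c ∉ I, X.face (Fin.castSucc (Fin.succ c)) x = X.face (Fin.castSucc (Fin.succ c)) y) :
    X.Joined I x y :=
  hX.joined (h.connected x y) fun c hc =>
    (face_eq_face_iff.1 (hI c hc)).mono fun d hd hdc => hd (by simp [hdc])

theorem PathIntersection.flagOf_injective (hX : X.PathIntersection) (h : X.IsManiplex) :
    Function.Injective (flagOf (X := X)) := fun x y hxy => by
  refine joined_empty_iff.1 (hX.joined_of_face_eq h fun c _ => ?_)
  have hx : X.face c.succ.castSucc x ∈ flagOf x := mem_flagOf.2 rfl
  rw [hxy] at hx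
  exact (mem_flagOf.1 hx).symm

theorem PathIntersection.r_eq_iff_flagAdj (hX : X.PathIntersection) (h : X.IsManiplex) (i : Fin n)
    (x y : V) : X.r i x = y ↔
      FlagAdj (fun F : X.Face => ((F.level : ℕ) : ℤ) - 1) (i : ℕ) (flagOf x) (flagOf y) := by
  constructor
  · rintro rfl
    refine ⟨fun hxy => h.no_semiedge i x (hX.flagOf_injective h hxy).symm, fun F hF => ?_⟩
    rw [mem_flagOf, mem_flagOf, face_r]
    intro hi
    apply hF
    change ((F.level : ℕ) : ℤ) - 1 = _
    rw [← hi]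
    push_cast
    ring
  · rintro ⟨hne, hF⟩
    have hj : X.Joined {i} x y := by
      refine hX.joined_of_face_eq h fun c hc => ?_
      have hx : X.face c.succ.castSucc x ∈ flagOf x := mem_flagOf.2 rfl
      refine (mem_flagOf.1 ((hF _ fun hci => hc (Fin.ext ?_)).1 hx)).symm
      simp at hci
      exact hci
    rcases hj.eq_or_eq_r with rfl | rfl
    · exact absurd rfl hne
    · rfl

/-- The diamond condition: the two faces in question are those of two adjacent flags. A third one would
give, together with the other faces of one of these flags, a third adjacent flag. -/
theorem PathIntersection.ncard_between (hX : X.PathIntersection) (h : X.IsManiplex) (hFG : F < G)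
    (hl : (G.level : ℕ) = F.level + 2) : {H : X.Face | F < H ∧ H < G}.ncard = 2 := by
  let := h.boundedOrder
  obtain ⟨x, hxF, hxG⟩ := hFG.le.2
  have hG := G.level.2
  let c : Fin n := ⟨F.level, by omega⟩
  have hc : ((c.succ.castSucc : Fin (n + 2)) : ℕ) = F.level + 1 := rfl
  have hcF : X.face F.level (X.r c x) = F := by
    rw [face_r (Nat.succ_ne_self _), hxF]
  have hcG : X.face G.level (X.r c x) = G := by
    rw [face_r (by rw [hl]; exact (Nat.lt_succ_self _).ne), hxG]
  have between : ∀ z, X.face F.level z = F → X.face G.level z = G →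
      F < X.face c.succ.castSucc z ∧ X.face c.succ.castSucc z < G := fun z hzF hzG => by
    constructor
    · conv_lhs => rw [← hzF]
      exact face_lt_face (Fin.lt_def.2 (by omega))
    · conv_rhs => rw [← hzG]
      exact face_lt_face (Fin.lt_def.2 (by omega))
  suffices hset : {H : X.Face | F < H ∧ H < G} =
      {X.face c.succ.castSucc x, X.face c.succ.castSucc (X.r c x)} by
    rw [hset, Set.ncard_pair]
    intro heq
    refine h.no_semiedge c x (joined_empty_iff.1 (hX.joined_of_face_eq h fun d _ => ?_))
    by_cases hd : d = c
    · rw [hd, heq]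
    · exact face_r (fun hcd => hd (Fin.ext (by simpa using hcd.symm))) x
  ext H
  simp only [Set.mem_ofPred_eq, Set.mem_insert_iff, Set.mem_singleton_iff]
  constructor
  · rintro ⟨hFH, hHG⟩
    have h1 : (F.level : ℕ) < H.level := Face.level_strictMono hFH
    have h2 : (H.level : ℕ) < G.level := Face.level_strictMono hHG
    have hH : H.level = c.succ.castSucc := Fin.ext (by omega)
    have hchain : IsChain (· ≤ ·)
        (insert H {K | K ∈ flagOf (X := X) x ∧ K.level ≠ c.succ.castSucc}) := by
      refine ((flagOf x).chain_le.mono fun K hK => hK.1).insert ?_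
      rintro K ⟨hK, hKc⟩ -
      rcases lt_or_gt_of_ne hKc with hlt | hlt
      · exact Or.inr ((Face.le_of_level_le hK hxF (Fin.le_def.2 (by omega))).trans hFH.le)
      · exact Or.inl (hHG.le.trans (Face.le_of_level_le hxG hK (Fin.le_def.2 (by omega))))
    obtain ⟨Φ, hΦ⟩ := hchain.exists_subset_flag
    obtain ⟨y, rfl⟩ := exists_flagOf_eq Φ
    have hHy : X.face H.level y = H := hΦ (Set.mem_insert _ _)
    have hj : X.Joined {c} x y := by
      refine hX.joined_of_face_eq h fun d hd => ?_
      refine (mem_flagOf.1 (hΦ (Set.mem_insert_of_mem _ ⟨mem_flagOf.2 rfl, ?_⟩))).symm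
      rintro hdc
      exact hd (Fin.ext (by simpa [Fin.ext_iff] using hdc))
    rw [hH] at hHy
    rcases hj.eq_or_eq_r with rfl | rfl
    · exact Or.inl hHy.symm
    · exact Or.inr hHy.symm
  · rintro (rfl | rfl)
    · exact between x hxF hxG
    · exact between _ hcF hcG

/-- The polytope of a maniplex with the path intersection property. -/
noncomputable def IsManiplex.polytope (h : X.IsManiplex) (hX : X.PathIntersection) :
    AbstractPolytope.{u} n where
  Face := X.Face
  boundedOrder := h.boundedOrder
  rank F := ((F.level : ℕ) : ℤ) - 1
  rank_bot := by
    change (((X.face 0 _).level : ℕ) : ℤ) - 1 = -1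
    simp
  rank_top := by
    change (((X.face (Fin.last _) _).level : ℕ) : ℤ) - 1 = n
    simp
  rank_strictMono F G hFG := by
    have : (F.level : ℕ) < G.level := Face.level_strictMono hFG
    simp only
    omega
  rank_covBy F G hFG := by
    have hlt : (F.level : ℕ) < G.level := Face.level_strictMono hFG.1
    obtain ⟨x, hxF, hxG⟩ := hFG.1.le.2
    by_contra hne
    have hb := G.level.2
    refine hFG.2 (c := X.face ⟨F.level + 1, by omega⟩ x) ?_ ?_
    · conv_lhs => rw [← hxF]
      exact face_lt_face (Fin.lt_def.2 (Nat.lt_succ_self _))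
    · conv_rhs => rw [← hxG]
      refine face_lt_face (Fin.lt_def.2 ?_)
      change (F.level : ℕ) + 1 < G.level
      omega
  diamond F G hFG hr := hX.ncard_between h hFG (by omega)
  flagConnected Φ Ψ := by
    let := h.boundedOrder
    obtain ⟨x, rfl⟩ := exists_flagOf_eq Φ
    obtain ⟨y, rfl⟩ := exists_flagOf_eq Ψ
    have hxy : X.Joined {c : Fin n | X.face c.succ.castSucc x ≠ X.face c.succ.castSucc y} x y :=
      hX.joined_of_face_eq h fun c hc => not_not.1 hc
    -- No path with these colours leaves a common face of `x` and `y`.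
    have hsub : ∀ z, X.Joined {c : Fin n | X.face c.succ.castSucc x ≠ X.face c.succ.castSucc y} z y →
        (flagOf (X := X) x : Set X.Face) ∩ flagOf (X := X) y ⊆ flagOf (X := X) z := by
      rintro z hz F ⟨hFx, hFy⟩
      refine mem_flagOf.2 ((hz.face_eq fun c hc hcF => hc ?_).trans hFy)
      have : c.succ.castSucc = F.level := Fin.ext (by simpa using hcF)
      rw [this]
      exact (mem_flagOf.1 hFx).trans (mem_flagOf.1 hFy).symm
    refine hxy.induction (p := fun z => Relation.ReflTransGen _ (flagOf z) (flagOf y)) .refl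
      fun i hi z hz ih => .head ⟨⟨(i : ℕ), (hX.r_eq_iff_flagAdj h i z _).1 rfl⟩, ?_, hsub _ hz⟩ ih
    exact hsub _ ((joined_r hi z).trans hz)

/-- A premaniplex is the flag graph of a polytope if and only if it is a maniplex with the path
intersection property. -/
theorem isPolytope_iff : X.IsPolytope ↔ X.IsManiplex ∧ X.PathIntersection := by
  refine ⟨fun h => ⟨h.isManiplex, h.pathIntersection⟩, fun ⟨h, hX⟩ => ?_⟩
  let := h.boundedOrder
  exact ⟨h.polytope hX, Equiv.ofBijective flagOf ⟨hX.flagOf_injective h, exists_flagOf_eq⟩,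
    hX.r_eq_iff_flagAdj h⟩

end Premaniplex

/-! ### Cayley extensions -/

/-- A path of the base with voltage `a` lifts to a path that multiplies the second component by `a`. -/
theorem VoltageAssignment.endpoint_derived {n : ℕ} {V : Type u} {X : Premaniplex n V} {G : Type v}
    [Group G] (ξ : VoltageAssignment X G) (x : V) (g : G) (w : List (Fin n)) :
    ξ.derived.endpoint (x, g) w = (X.endpoint x w, ξ.voltage x w * g) := by
  induction w generalizing x g with
  | nil => simp [Premaniplex.endpoint, voltage, Premaniplex.pathVoltage]
  | cons i w ih =>
    refine (ih _ _).trans (Prod.ext rfl ?_)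
    exact (mul_assoc _ _ _).symm

namespace CayleyExtender

variable {n : ℕ} {V : Type u} {K : Premaniplex n V} {G : Type v} [Group G]
  (E : CayleyExtender K G) {I : Set (Fin n)} {J : Set (Fin (n + 1))} {x y : V}

theorem preExtension_r_last (x : V) : E.preExtension.r (Fin.last n) x = E.rn x := by
  simp [preExtension]

theorem preExtension_r_castSucc (i : Fin n) (x : V) :
    E.preExtension.r i.castSucc x = K.r i x := by
  simp [preExtension]

theorem extension_r_last (p : V × G) :
    E.extension.r (Fin.last n) p = (E.rn p.1, E.ξ (K.facetOf p.1) * p.2) := by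
  simp [extension, VoltageAssignment.derived, voltageAssignment, preExtension_r_last]

theorem extension_r_castSucc (i : Fin n) (p : V × G) :
    E.extension.r i.castSucc p = (K.r i p.1, p.2) := by
  simp [extension, VoltageAssignment.derived, voltageAssignment, preExtension_r_castSucc]

theorem joined_preExtension_iff (hJ : Fin.last n ∉ J) :
    E.preExtension.Joined J x y ↔ K.Joined (Fin.castSucc ⁻¹' J) x y := by
  constructor
  · refine fun h => h.induction (p := fun x => K.Joined _ x y) (.refl _ _) fun i hi z _ ih => ?_
    obtain ⟨i, rfl⟩ | rfl := i.eq_castSucc_or_eq_last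
    · rw [preExtension_r_castSucc] at ih
      exact (Premaniplex.joined_r (I := Fin.castSucc ⁻¹' J) hi z).trans ih
    · exact absurd hi hJ
  · refine fun h => h.induction (p := fun x => E.preExtension.Joined _ x y) (.refl _ _)
      fun i hi z _ ih => ?_
    rw [← E.preExtension_r_castSucc] at ih
    exact (Premaniplex.joined_r (X := E.preExtension) (I := J) hi z).trans ih

/-- Paths without colour `n` do not change the second component. -/
theorem joined_extension_iff (hJ : Fin.last n ∉ J) {p q : V × G} :
    E.extension.Joined J p q ↔ K.Joined (Fin.castSucc ⁻¹' J) p.1 q.1 ∧ p.2 = q.2 := by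
  constructor
  · refine fun h => h.induction (p := fun p => K.Joined _ p.1 q.1 ∧ p.2 = q.2) ⟨.refl _ _, rfl⟩
      fun i hi z _ ih => ?_
    obtain ⟨i, rfl⟩ | rfl := i.eq_castSucc_or_eq_last
    · rw [extension_r_castSucc] at ih
      exact ⟨(Premaniplex.joined_r (I := Fin.castSucc ⁻¹' J) hi z.1).trans ih.1, ih.2⟩
    · exact absurd hi hJ
  · obtain ⟨x, g⟩ := p
    obtain ⟨y, g'⟩ := q
    rintro ⟨h, rfl : g = g'⟩
    refine h.induction (p := fun x => E.extension.Joined _ (x, g) (y, g)) (.refl _ _)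
      fun i hi z _ ih => ?_
    have := Premaniplex.joined_r (X := E.extension) (I := J) hi (z, g)
    rw [extension_r_castSucc] at this
    exact this.trans ih

/-- The paths of the derived graph are the lifts of the paths of the base. -/
theorem joined_extension_self_iff (g : G) : E.extension.Joined J (x, g) (y, g) ↔
    {W ∈ E.preExtension.paths J x y | E.voltageAssignment.voltage x W = 1}.Nonempty := by
  refine exists_congr fun w => ?_
  change (_ ∧ E.voltageAssignment.derived.endpoint (x, g) w = (y, g)) ↔ (_ ∧ _) ∧ _
  rw [VoltageAssignment.endpoint_derived, Prod.mk.injEq, mul_eq_right, and_assoc]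

theorem rn_eq_self_of_facetOf_eq (hx : E.rn x = x) (h : K.facetOf y = K.facetOf x) :
    E.rn y = y := by
  have hyx : K.Joined {i | (i : ℕ) + 1 ≠ n} y x := Quotient.exact h
  refine hyx.induction (p := fun z => E.rn z = z) hx fun i hi z _ ih => ?_
  have hi' : (i : ℕ) + 1 < n := lt_of_le_of_ne i.2 hi
  rw [E.rn_comm i hi'] at ih
  simpa only [K.r_r] using congrArg (K.r i) ih

variable {E}

theorem Admissible.joined_univ (hE : E.Admissible) (p q : V × G) :
    E.extension.Joined Set.univ p q := by
  have hK : ∀ (x y : V) (g : G), E.extension.Joined Set.univ (x, g) (y, g) := fun x y g =>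
    ((E.joined_extension_iff (J := {i | i ≠ Fin.last n}) (p := (x, g)) (q := (y, g)) (by simp)).2
      ⟨E.isManiplex.joined (fun i => Fin.castSucc_ne_last i) x y, rfl⟩).mono (Set.subset_univ _)
  have key : ∀ a ∈ Subgroup.closure (Set.range E.ξ), ∀ (x y : V) (g : G),
      E.extension.Joined Set.univ (x, g) (y, a * g) := by
    intro a ha
    induction ha using Subgroup.closure_induction with
    | mem a ha =>
      intro x y g
      obtain ⟨F, rfl⟩ := ha
      obtain ⟨z, rfl⟩ := Quotient.exists_rep F
      have := Premaniplex.joined_r (X := E.extension) (Set.mem_univ (Fin.last n)) (z, g)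
      rw [extension_r_last] at this
      exact ((hK x z g).trans this).trans (hK _ y _)
    | one => simpa using hK
    | mul a b _ _ iha ihb =>
      intro x y g
      rw [mul_assoc]
      exact (ihb x x g).trans (iha x y _)
    | inv a _ ih =>
      intro x y g
      simpa using (ih y x (a⁻¹ * g)).symm
  have := key (q.2 * p.2⁻¹) (hE.generates ▸ Subgroup.mem_top _) p.1 q.1 p.2
  simpa using this

theorem Admissible.isManiplex_extension (hE : E.Admissible) : E.extension.IsManiplex where
  nonempty := ⟨E.isManiplex.nonempty.some, 1⟩
  connected := hE.joined_univ
  no_semiedge i p hp := by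
    obtain ⟨i, rfl⟩ | rfl := i.eq_castSucc_or_eq_last
    · rw [extension_r_castSucc] at hp
      exact E.isManiplex.no_semiedge i p.1 (congrArg Prod.fst hp)
    · rw [extension_r_last] at hp
      exact hE.ne_one _ (Or.inl fun y hy => E.rn_eq_self_of_facetOf_eq (congrArg Prod.fst hp) hy)
        (mul_eq_right.1 (congrArg Prod.snd hp))
  no_parallel i j hij p hp := by
    have aux : ∀ k : Fin n, E.extension.r (Fin.last n) p ≠ E.extension.r k.castSucc p := fun k hk => by
      rw [extension_r_last, extension_r_castSucc] at hk
      exact hE.ne_one _ (Or.inr ⟨p.1, k, rfl, congrArg Prod.fst hk⟩)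
        (mul_eq_right.1 (congrArg Prod.snd hk))
    obtain ⟨i, rfl⟩ | rfl := i.eq_castSucc_or_eq_last <;>
      obtain ⟨j, rfl⟩ | rfl := j.eq_castSucc_or_eq_last
    · rw [extension_r_castSucc, extension_r_castSucc] at hp
      exact E.isManiplex.no_parallel i j (fun h => hij (h ▸ rfl)) p.1 (congrArg Prod.fst hp)
    · exact aux i hp.symm
    · exact aux j hp
    · exact hij rfl

theorem joined_preExtension_Ico_iff (k : Fin (n + 1)) :
    E.preExtension.Joined (Set.Ico k (Fin.last n)) x y ↔ K.Joined {c | (k : ℕ) ≤ c} x y := by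
  rw [E.joined_preExtension_iff (by simp)]
  have : Fin.castSucc ⁻¹' Set.Ico k (Fin.last n) = {c : Fin n | (k : ℕ) ≤ c} := by
    ext c
    simp [Fin.le_def, Fin.castSucc_lt_last]
  rw [this]

theorem Icc_last_eq (k : Fin (n + 1)) :
    Set.Icc k (Fin.last n) = {c : Fin (n + 1) | (k : ℕ) ≤ c} := by
  ext c
  exact ⟨fun h => h.1, fun h => ⟨h, Fin.le_last c⟩⟩

variable (E) in
/-- The path intersection property of the extension splits into that of `K`, which concerns paths without
colour `n`, and the condition that colour `n` can be avoided when the voltage is trivial. -/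
theorem pathIntersection_extension_iff : E.extension.PathIntersection ↔ K.PathIntersection ∧
    ∀ (x y : V) (k : Fin (n + 1)),
      {W ∈ E.preExtension.paths (Set.Icc k (Fin.last n)) x y |
        E.voltageAssignment.voltage x W = 1}.Nonempty →
      (E.preExtension.paths (Set.Ico k (Fin.last n)) x y).Nonempty := by
  constructor
  · refine fun h => ⟨fun x y k m h1 h2 => ?_, fun x y k hk => ?_⟩
    · have h1' : E.extension.Joined {c | k ≤ (c : ℕ) ∧ (c : ℕ) < n} (x, 1) (y, 1) :=
        (E.joined_extension_iff (by simp)).2 ⟨h1.mono fun c hc => ⟨hc, c.2⟩, rfl⟩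
      have h2' : E.extension.Joined {c | (c : ℕ) < min m n} (x, 1) (y, 1) :=
        (E.joined_extension_iff (by simp)).2 ⟨h2.mono fun c hc => lt_min hc c.2, rfl⟩
      have := h (x, 1) (y, 1) k (min m n) (h1'.mono fun c hc => hc.1) h2'
      exact ((E.joined_extension_iff (by simp)).1 this).1.mono fun c hc =>
        ⟨hc.1, lt_of_lt_of_le hc.2 (min_le_left _ _)⟩
    · rw [← E.joined_extension_self_iff 1, Icc_last_eq] at hk
      refine (joined_preExtension_Ico_iff k).2 ?_
      have h2 : E.extension.Joined {c | (c : ℕ) < n} (x, 1) (y, 1) :=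
        (E.joined_extension_iff (by simp)).2
          ⟨E.isManiplex.joined (fun c => c.2) x y, rfl⟩
      exact ((E.joined_extension_iff (by simp)).1 (h _ _ _ _ hk h2)).1.mono fun c hc => hc.1
  · rintro ⟨hK, h⟩ ⟨x, g⟩ ⟨y, g'⟩ k m h1 h2
    rcases lt_or_ge n m with hm | hm
    · exact h1.mono fun c hc => ⟨hc, lt_of_lt_of_le c.2 hm⟩
    obtain ⟨h2, rfl : g = g'⟩ := (E.joined_extension_iff (by simpa using hm)).1 h2
    refine (E.joined_extension_iff (by simpa using fun _ => hm)).2 ⟨?_, rfl⟩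
    refine hK x y k m ?_ h2
    rcases lt_or_ge n k with hk | hk
    · -- No colour is `≥ k`, so the first path has length `0`.
      have := h1.mono (J := ∅) fun c (hc : k ≤ c) => by have := c.2; omega
      rw [(Prod.mk.inj (Premaniplex.joined_empty_iff.1 this)).1]
      exact .refl _ _
    · refine (joined_preExtension_Ico_iff ⟨k, Nat.lt_succ_of_le hk⟩).1 (h x y _ ?_)
      rw [← E.joined_extension_self_iff g, Icc_last_eq]
      exact h1

theorem Admissible.isPolytope_extension_iff (hE : E.Admissible) : E.extension.IsPolytope ↔
    K.IsPolytope ∧ ∀ (x y : V) (k : Fin (n + 1)),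
      {W ∈ E.preExtension.paths (Set.Icc k (Fin.last n)) x y |
        E.voltageAssignment.voltage x W = 1}.Nonempty →
      (E.preExtension.paths (Set.Ico k (Fin.last n)) x y).Nonempty := by
  rw [Premaniplex.isPolytope_iff, Premaniplex.isPolytope_iff, E.pathIntersection_extension_iff,
    and_iff_right hE.isManiplex_extension, and_iff_right E.isManiplex]

/-- In a canonical extender the edges of colour `n` are semi-edges and can be dropped from a path. -/
theorem IsCanonical.joined_Ico (hE : E.IsCanonical) {k : Fin (n + 1)}
    (h : E.preExtension.Joined (Set.Icc k (Fin.last n)) x y) :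
    E.preExtension.Joined (Set.Ico k (Fin.last n)) x y := by
  refine h.induction (p := fun x => E.preExtension.Joined _ x y) (.refl _ _) fun i hi z _ ih => ?_
  rcases hi.2.eq_or_lt with rfl | hlt
  · rwa [preExtension_r_last, hE z] at ih
  · exact (Premaniplex.joined_r (I := Set.Ico k (Fin.last n)) ⟨hi.1, hlt⟩ z).trans ih

end CayleyExtender
theorem proposition3p12 {n : ℕ} (hn : 1 ≤ n) {V : Type u} {G : Type v} [Group G]
    (K : Premaniplex n V) :
    (∀ E : CayleyExtender K G, E.Admissible →
      (E.extension.IsPolytope ↔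
        K.IsPolytope ∧
        ∀ (Φ Ψ : V) (k : Fin (n + 1)),
          {W ∈ E.preExtension.paths (Set.Icc k (Fin.last n)) Φ Ψ |
            E.voltageAssignment.voltage Φ W = 1}.Nonempty →
          (E.preExtension.paths (Set.Ico k (Fin.last n)) Φ Ψ).Nonempty)) ∧
    (∀ E : CayleyExtender K G, E.Admissible → E.IsCanonical →
      (E.extension.IsPolytope ↔ K.IsPolytope)) := by
  refine ⟨fun E hE => hE.isPolytope_extension_iff, fun E hE hcan =>
    hE.isPolytope_extension_iff.trans (and_iff_left fun Φ Ψ k hk => ?_)⟩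
  exact hcan.joined_Ico (hk.mono fun W hW => hW.1)
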